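/- For integers $n,k\ge 1$ and matrices $A\in\mathbb{C}^{n\times n}$, $B\in\mathbb{C}^{n\times k}$, let $W(t)=\sum_{i=0}^{t}A^iBB^*(A^*)^i$ be the controllability Gramian, let $\lambda_{\min}(W(t))$ be its smallest eigenvalue, and let $t_{\min}=\lceil n/k\rceil-1$. For a compact set $K\subset\mathbb{C}$ let $$I(K)=\sup_{\mu}\int_{K\times K}\log|z-w|\,d\mu(z)\,d\mu(w)\in[-\infty,\infty),\qquad \mathrm{cap}(K)=e^{I(K)},$$ where the supremum is over all Borel probability measures $\mu$ supported on $K$, and $\log 0=-\infty$, $e^{-\infty}=0$. Let $\mathcal{X}\subset\mathbb{C}$ be a compact set with $\mathrm{cap}(\mathcal{X})>0$. Then there is a sequence $(\varepsilon_l)_{l\ge 0}$ of real numbers, depending only on $\mathcal{X}$, with $\varepsilon_l\to 0$ as $l\to\infty$, such that the following holds. For all $n,k\ge 1$, all $A\in\mathbb{C}^{n\times n}$ and $B\in\mathbb{C}^{n\times k}$ such that all eigenvalues of $A$ lie in $\mathcal{X}$, and every invertible $V\in\mathbb{C}^{n\times n}$ such that $VAV^{-1}$ is diagonal, $$\lambda_{\min}\bigl(W(t_{\min})\bigr)\le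 \mathrm{cond}(V)^2\,\|B\|_F^2\,\Bigl((1+\varepsilon_{t_{\min}})\,\mathrm{cap}(\mathcal{X})^2\Bigr)^{t_{\min}},$$ where $\mathrm{cond}(V)=\|V\|_2\|V^{-1}\|_2$ is the condition number in the spectral norm and $\|B\|_F$ is the Frobenius norm. -/

import Mathlib

open MeasureTheory Filter Topology
open scoped ENNReal Matrix

/-! Control theory -/

/-- The controllability Gramian `W(t) = ∑_{i=0}^{t} Aⁱ B B* (A*)ⁱ`. -/
def gramian {n k : ℕ} (A : Matrix (Fin n) (Fin n) ℂ) (B : Matrix (Fin n) (Fin k) ℂ) (t : ℕ) :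
    Matrix (Fin n) (Fin n) ℂ :=
  ∑ i ∈ Finset.range (t + 1), A ^ i * B * Bᴴ * Aᴴ ^ i

theorem gramian_isHermitian {n k : ℕ} (A : Matrix (Fin n) (Fin n) ℂ)
    (B : Matrix (Fin n) (Fin k) ℂ) (t : ℕ) : (gramian A B t).IsHermitian := by
  simp [gramian, Matrix.IsHermitian, Matrix.conjTranspose_sum, Matrix.conjTranspose_mul,
    Matrix.conjTranspose_pow, Matrix.mul_assoc]

/-- The smallest eigenvalue of a Hermitian matrix (of size at least one). -/
noncomputable def lambdaMin {n : ℕ} {M : Matrix (Fin n) (Fin n) ℂ} (hM : M.IsHermitian) : ℝ :=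
  ⨅ i, hM.eigenvalues i

/-- The first time `⌈n/k⌉ - 1` at which a system with `n` states and `k` inputs can become
controllable (for `n, k ≥ 1`). -/
noncomputable def tMin (n k : ℕ) : ℕ := ⌈(n : ℝ) / (k : ℝ)⌉₊ - 1

open scoped Matrix.Norms.L2Operator in
/-- The condition number `‖V‖₂ ‖V⁻¹‖₂` of an invertible matrix, for the spectral norm. -/
noncomputable def condNumber {n : ℕ} (V : Matrix (Fin n) (Fin n) ℂ) : ℝ := ‖V‖ * ‖V⁻¹‖

open scoped Matrix.Norms.Frobenius in
/-- The Frobenius norm. -/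
noncomputable def frobeniusNorm {n k : ℕ} (B : Matrix (Fin n) (Fin k) ℂ) : ℝ := ‖B‖

/-! Logarithmic capacity -/

/-- The extended-real integral `∫∫ log |z - w| dμ(z) dμ(w)`, with `log 0 = -∞`, as the integral of
the positive part minus the integral of the negative part. For a finite measure carried by a
bounded set the first one is finite, so the difference is never of the form `∞ - ∞`. -/
noncomputable def logEnergy (μ : Measure ℂ) : EReal :=
  ((∫⁻ p : ℂ × ℂ, (ENNReal.log (edist p.1 p.2)).toENNReal ∂(μ.prod μ) : ℝ≥0∞) : EReal) -
    ((∫⁻ p : ℂ × ℂ, (-ENNReal.log (edist p.1 p.2)).toENNReal ∂(μ.prod μ) : ℝ≥0∞) : EReal)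

/-- The logarithmic energy `I(K)` of a compact set `K`: the supremum of the energies of the Borel
probability measures supported on `K`. -/
noncomputable def logEnergySup (K : Set ℂ) : EReal :=
  ⨆ (μ : Measure ℂ) (_ : IsProbabilityMeasure μ ∧ μ Kᶜ = 0), logEnergy μ

/-- The logarithmic capacity `cap(K) = exp(I(K))` of a compact set `K`, with `exp(-∞) = 0`. -/
noncomputable def logCapacity (K : Set ℂ) : ℝ≥0∞ := EReal.exp (logEnergySup K)

/-!
Write `t = ⌈n/k⌉ - 1`. The matrix `[B, AB, …, A^{t-1}B]` has `tk < n` columns, so some unit vector `x`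
is orthogonal to all of them, and then `x* W(t) x = ‖(AᵗB)* x‖² = ‖(p(A)B)* x‖²` for every monic `p` of
degree `t`. Since `A` is diagonalized by `V`, this is at most `cond(V)² ‖B‖_F² ‖p‖_X²`, where `‖p‖_X` is
the maximum of `|p|` on `X` (`lambdaMin_gramian_le`).

It remains to find monic `p` of degree `m` with `‖p‖_X ≤ r_m ^ m` and `r_m → cap X`, the upper half of
the Fekete–Szegő theorem (`eventually_exists_monic_norm_eval_le`). Suppose that, for some
`η > cap X` and infinitely many `m`, every monic polynomial of degree `m` exceeds `η ^ m` somewhere on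
`X`. Then `m + 1` points of `X` with maximal product of mutual distances have
`∏_{i ≠ j} |z_i - z_j| ≥ η ^ (m (m + 1))` (`exists_pow_le_pairProd`): as a function of one of the
points, the product of its distances to the others is the modulus of a monic polynomial of degree `m`,
maximal at that point. The uniform measures on these points have a weak limit along an ultrafilter,
as the probability measures on a compact space form a compact space. Integrating the kernel
`log max(|z - w|, δ)`, which is continuous, gives at least `log η` in the limit for each `δ`, and `δ → 0`
shows that the limit measure has energy at least `log η` (`le_logEnergy_of_forall_truncLog`), so that
`cap X ≥ η`, a contradiction.
-/

/-! ### The smallest eigenvalue of the Gramian and monic polynomials -/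

theorem tMin_mul_lt {n k : ℕ} (hn : 0 < n) (hk : 0 < k) : tMin n k * k < n := by
  have hk' : (0 : ℝ) < k := by exact_mod_cast hk
  have hpos : 0 < ⌈(n : ℝ) / (k : ℝ)⌉₊ := Nat.ceil_pos.2 (by positivity)
  have h : tMin n k < ⌈(n : ℝ) / (k : ℝ)⌉₊ := by unfold tMin; omega
  rw [Nat.lt_ceil, lt_div_iff₀ hk'] at h
  exact_mod_cast h

/-- The Rayleigh quotient is at least the smallest eigenvalue. -/
theorem lambdaMin_mul_norm_sq_le {n : ℕ} {M : Matrix (Fin n) (Fin n) ℂ} (hM : M.IsHermitian)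
    (x : EuclideanSpace ℂ (Fin n)) :
    lambdaMin hM * ‖x‖ ^ 2 ≤ (star x.ofLp ⬝ᵥ M *ᵥ x.ofLp).re := by
  set b := hM.eigenvectorBasis
  have hsum : star x.ofLp ⬝ᵥ M *ᵥ x.ofLp =
      ∑ i, (hM.eigenvalues i : ℂ) * (‖inner ℂ (b i) x‖ : ℂ) ^ 2 := by
    have h1 : star x.ofLp ⬝ᵥ M *ᵥ x.ofLp = inner ℂ x (WithLp.toLp 2 (M *ᵥ x.ofLp)) := by
      rw [EuclideanSpace.inner_eq_star_dotProduct, dotProduct_comm]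
    rw [h1, ← b.sum_inner_mul_inner]
    refine Finset.sum_congr rfl fun i _ => ?_
    have h2 : inner ℂ (b i) (WithLp.toLp 2 (M *ᵥ x.ofLp)) = hM.eigenvalues i * inner ℂ (b i) x := by
      rw [EuclideanSpace.inner_eq_star_dotProduct, EuclideanSpace.inner_eq_star_dotProduct,
        dotProduct_comm, Matrix.dotProduct_mulVec]
      have h3 : star (b i).ofLp ᵥ* M = (hM.eigenvalues i : ℂ) • star (b i).ofLp := by
        have := congrArg star (hM.mulVec_eigenvectorBasis i)
        rw [Matrix.star_mulVec, hM.eq] at this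
        rw [this]
        ext j
        simp [b]
      rw [h3, smul_dotProduct, dotProduct_comm, smul_eq_mul]
    rw [h2, ← inner_conj_symm, mul_left_comm, RCLike.conj_mul]
    rfl
  rw [hsum, Complex.re_sum, ← b.sum_sq_norm_inner_right x, Finset.mul_sum]
  refine Finset.sum_le_sum fun i _ => ?_
  have : ((hM.eigenvalues i : ℂ) * (‖inner ℂ (b i) x‖ : ℂ) ^ 2).re
      = hM.eigenvalues i * ‖inner ℂ (b i) x‖ ^ 2 := by
    rw [← Complex.ofReal_pow, ← Complex.ofReal_mul, Complex.ofReal_re]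
  rw [this]
  exact mul_le_mul_of_nonneg_right (ciInf_le (Set.finite_range _).bddBelow i) (by positivity)

theorem star_dotProduct_gramian_mulVec {n k : ℕ} (A : Matrix (Fin n) (Fin n) ℂ)
    (B : Matrix (Fin n) (Fin k) ℂ) (t : ℕ) (x : Fin n → ℂ) :
    (star x ⬝ᵥ gramian A B t *ᵥ x).re =
      ∑ i ∈ Finset.range (t + 1), ‖WithLp.toLp 2 ((A ^ i * B)ᴴ *ᵥ x)‖ ^ 2 := by
  have key (C : Matrix (Fin n) (Fin k) ℂ) :
      (star x ⬝ᵥ (C * Cᴴ) *ᵥ x).re = ‖WithLp.toLp 2 (Cᴴ *ᵥ x)‖ ^ 2 := by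
    rw [← Matrix.mulVec_mulVec, Matrix.dotProduct_mulVec, ← Matrix.conjTranspose_conjTranspose C,
      ← Matrix.star_mulVec, Matrix.conjTranspose_conjTranspose, dotProduct_comm,
      ← EuclideanSpace.inner_toLp_toLp, inner_self_eq_norm_sq_to_K]
    norm_cast
  have hg : gramian A B t = ∑ i ∈ Finset.range (t + 1), (A ^ i * B) * (A ^ i * B)ᴴ := by
    simp [gramian, Matrix.conjTranspose_mul, Matrix.conjTranspose_pow, Matrix.mul_assoc]
  rw [hg, Matrix.sum_mulVec, dotProduct_sum, Complex.re_sum]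
  exact Finset.sum_congr rfl fun i _ => key _

/-- With fewer than `n` columns in `[B, AB, …, A^{t-1}B]`, some nonzero vector is orthogonal to all
of them. -/
theorem exists_ne_zero_orthogonal_krylov {n k t : ℕ} (h : t * k < n)
    (A : Matrix (Fin n) (Fin n) ℂ) (B : Matrix (Fin n) (Fin k) ℂ) :
    ∃ x : Fin n → ℂ, x ≠ 0 ∧ ∀ i < t, (A ^ i * B)ᴴ *ᵥ x = 0 := by
  let f : (Fin n → ℂ) →ₗ[ℂ] (Fin t → Fin k → ℂ) :=
    LinearMap.pi fun i => Matrix.mulVecLin (A ^ (i : ℕ) * B)ᴴ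
  have hker : LinearMap.ker f ≠ ⊥ := by
    apply LinearMap.ker_ne_bot_of_finrank_lt
    simpa [Module.finrank_pi_fintype] using h
  obtain ⟨x, hx, hx0⟩ := Submodule.exists_mem_ne_zero_of_ne_bot hker
  refine ⟨x, hx0, fun i hi => ?_⟩
  exact congrFun (LinearMap.mem_ker.1 hx) ⟨i, hi⟩

theorem norm_conjTranspose_mulVec_le_frobeniusNorm {n k : ℕ} (B : Matrix (Fin n) (Fin k) ℂ)
    (v : Fin n → ℂ) :
    ‖WithLp.toLp 2 (Bᴴ *ᵥ v)‖ ≤ frobeniusNorm B * ‖WithLp.toLp 2 v‖ := by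
  open scoped Matrix.Norms.Frobenius in
  have h := Matrix.frobenius_norm_mul Bᴴ (Matrix.replicateCol Unit v)
  rw [← Matrix.replicateCol_mulVec, Matrix.frobenius_norm_replicateCol,
    Matrix.frobenius_norm_replicateCol, Matrix.frobenius_norm_conjTranspose] at h
  exact h

theorem diagonal_mem_spectrum {n : ℕ} {A V : Matrix (Fin n) (Fin n) ℂ} {d : Fin n → ℂ}
    (hV : IsUnit V) (hd : V * A * V⁻¹ = Matrix.diagonal d) (i : Fin n) : d i ∈ spectrum ℂ A := by
  obtain ⟨u, rfl⟩ := hV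
  rw [← Matrix.coe_units_inv] at hd
  rw [← spectrum.units_conjugate (u := u), hd, spectrum_diagonal]
  exact ⟨i, rfl⟩

theorem aeval_diagonal {n : ℕ} (p : Polynomial ℂ) (d : Fin n → ℂ) :
    Polynomial.aeval (Matrix.diagonal d) p = Matrix.diagonal fun i => p.eval (d i) := by
  have := Polynomial.aeval_algHom_apply (Matrix.diagonalAlgHom (n := Fin n) (α := ℂ) ℂ) d p
  rw [Matrix.diagonalAlgHom_apply, Matrix.diagonalAlgHom_apply] at this
  rw [this]
  congr 1
  ext i
  simp

open scoped Matrix.Norms.L2Operator in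
theorem norm_aeval_le_condNumber_mul {n : ℕ} {A V : Matrix (Fin n) (Fin n) ℂ} {d : Fin n → ℂ}
    (hV : IsUnit V) (hd : V * A * V⁻¹ = Matrix.diagonal d) (p : Polynomial ℂ) {r : ℝ}
    (hr : 0 ≤ r) (hp : ∀ i, ‖p.eval (d i)‖ ≤ r) :
    ‖Polynomial.aeval A p‖ ≤ condNumber V * r := by
  obtain ⟨u, rfl⟩ := hV
  have hA : Polynomial.aeval A p =
      (u : Matrix (Fin n) (Fin n) ℂ)⁻¹ * (Matrix.diagonal fun i => p.eval (d i)) * u := by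
    rw [← aeval_diagonal, ← hd, ← Matrix.coe_units_inv]
    have := Polynomial.aeval_algHom_apply (MulSemiringAction.toAlgHom ℂ
      (Matrix (Fin n) (Fin n) ℂ) (ConjAct.toConjAct u)) A p
    simp only [MulSemiringAction.toAlgHom_apply, ConjAct.units_smul_def, ConjAct.ofConjAct_toConjAct]
      at this
    rw [this]
    simp [← mul_assoc]
  rw [hA]
  calc _ ≤ ‖(u : Matrix (Fin n) (Fin n) ℂ)⁻¹‖ * ‖Matrix.diagonal fun i => p.eval (d i)‖
        * ‖(u : Matrix (Fin n) (Fin n) ℂ)‖ :=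
        (norm_mul_le _ _).trans (mul_le_mul_of_nonneg_right (norm_mul_le _ _) (norm_nonneg _))
    _ ≤ ‖(u : Matrix (Fin n) (Fin n) ℂ)⁻¹‖ * r * ‖(u : Matrix (Fin n) (Fin n) ℂ)‖ := by
        gcongr
        rw [Matrix.l2_opNorm_diagonal]
        exact (pi_norm_le_iff_of_nonneg hr).2 hp
    _ = _ := by unfold condNumber; ring

/-- A vector orthogonal to the columns of `B, AB, …, A^{t-1}B` sees `p(A)B` and `A^t B` alike, for
`p` monic of degree `t`. -/
theorem conjTranspose_aeval_mul_mulVec {n k t : ℕ} {A : Matrix (Fin n) (Fin n) ℂ}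
    {B : Matrix (Fin n) (Fin k) ℂ} {x : Fin n → ℂ} (hx : ∀ i < t, (A ^ i * B)ᴴ *ᵥ x = 0)
    {p : Polynomial ℂ} (hp : p.Monic) (hdeg : p.natDegree = t) :
    (Polynomial.aeval A p * B)ᴴ *ᵥ x = (A ^ t * B)ᴴ *ᵥ x := by
  rw [Polynomial.aeval_eq_sum_range, hdeg, Matrix.sum_mul, Matrix.conjTranspose_sum,
    Matrix.sum_mulVec, Finset.sum_range_succ, Finset.sum_eq_zero, zero_add]
  · rw [← hdeg, hp.coeff_natDegree, one_smul]
  · intro i hi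
    rw [Matrix.smul_mul, Matrix.conjTranspose_smul, Matrix.smul_mulVec, hx i (Finset.mem_range.1 hi),
      smul_zero]

theorem lambdaMin_gramian_le {n k t : ℕ} (h : t * k < n) (A : Matrix (Fin n) (Fin n) ℂ)
    (B : Matrix (Fin n) (Fin k) ℂ) {V : Matrix (Fin n) (Fin n) ℂ} {d : Fin n → ℂ}
    (hV : IsUnit V) (hd : V * A * V⁻¹ = Matrix.diagonal d) {p : Polynomial ℂ} (hp : p.Monic)
    (hdeg : p.natDegree = t) {r : ℝ} (hr : 0 ≤ r) (hpr : ∀ i, ‖p.eval (d i)‖ ≤ r) :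
    lambdaMin (gramian_isHermitian A B t) ≤ condNumber V ^ 2 * frobeniusNorm B ^ 2 * r ^ 2 := by
  obtain ⟨x, hx0, hx⟩ := exists_ne_zero_orthogonal_krylov h A B
  have hxpos : 0 < ‖WithLp.toLp 2 x‖ := by
    rw [norm_pos_iff]
    exact fun h0 => hx0 (by simpa using h0)
  have hB : 0 ≤ frobeniusNorm B := by
    open scoped Matrix.Norms.Frobenius in exact norm_nonneg B
  have hbound : ‖WithLp.toLp 2 ((A ^ t * B)ᴴ *ᵥ x)‖ ≤
      frobeniusNorm B * (condNumber V * r * ‖WithLp.toLp 2 x‖) := by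
    rw [← conjTranspose_aeval_mul_mulVec hx hp hdeg, Matrix.conjTranspose_mul,
      ← Matrix.mulVec_mulVec]
    refine (norm_conjTranspose_mulVec_le_frobeniusNorm B _).trans ?_
    gcongr
    open scoped Matrix.Norms.L2Operator in
    refine (Matrix.l2_opNorm_mulVec (Polynomial.aeval A p)ᴴ (WithLp.toLp 2 x)).trans ?_
    rw [Matrix.l2_opNorm_conjTranspose]
    gcongr
    exact norm_aeval_le_condNumber_mul hV hd p hr hpr
  have hquad : lambdaMin (gramian_isHermitian A B t) * ‖WithLp.toLp 2 x‖ ^ 2 ≤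
      ‖WithLp.toLp 2 ((A ^ t * B)ᴴ *ᵥ x)‖ ^ 2 := by
    refine (lambdaMin_mul_norm_sq_le (gramian_isHermitian A B t) (WithLp.toLp 2 x)).trans_eq ?_
    rw [star_dotProduct_gramian_mulVec, Finset.sum_range_succ, Finset.sum_eq_zero, zero_add]
    intro i hi
    rw [hx i (Finset.mem_range.1 hi)]
    simp
  refine le_of_mul_le_mul_right (hquad.trans ?_) (pow_pos hxpos 2)
  calc _ ≤ (frobeniusNorm B * (condNumber V * r * ‖WithLp.toLp 2 x‖)) ^ 2 := by gcongr
    _ = _ := by ring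

/-! ### Fekete points and logarithmic capacity -/

/-- The product of the distances over all ordered pairs of distinct indices: the square of the
modulus of the Vandermonde determinant. -/
noncomputable def pairProd {ι : Type*} [Fintype ι] [DecidableEq ι] (z : ι → ℂ) : ℝ :=
  ∏ i, ∏ j ∈ Finset.univ.erase i, ‖z i - z j‖

theorem pairProd_eq_sq_mul {ι : Type*} [Fintype ι] [DecidableEq ι] (z : ι → ℂ) (i : ι) :
    pairProd z = (∏ j ∈ Finset.univ.erase i, ‖z i - z j‖) ^ 2 *
      ∏ a ∈ Finset.univ.erase i, ∏ b ∈ (Finset.univ.erase a).erase i, ‖z a - z b‖ := by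
  rw [pairProd, ← Finset.mul_prod_erase _ _ (Finset.mem_univ i), sq, mul_assoc]
  congr 1
  rw [← Finset.prod_mul_distrib]
  refine Finset.prod_congr rfl fun a ha => ?_
  rw [← Finset.mul_prod_erase (Finset.univ.erase a) _
    (Finset.mem_erase.2 ⟨(Finset.ne_of_mem_erase ha).symm, Finset.mem_univ i⟩), norm_sub_rev]

theorem continuous_pairProd {ι : Type*} [Fintype ι] [DecidableEq ι] :
    Continuous (pairProd : (ι → ℂ) → ℝ) := by
  unfold pairProd
  fun_prop

theorem pairProd_pos {ι : Type*} [Fintype ι] [DecidableEq ι] {z : ι → ℂ}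
    (hz : Function.Injective z) : 0 < pairProd z :=
  Finset.prod_pos fun _ _ => Finset.prod_pos fun _ hj =>
    norm_pos_iff.2 (sub_ne_zero.2 (hz.ne (Finset.ne_of_mem_erase hj).symm))

theorem pairProd_update_eq {ι : Type*} [Fintype ι] [DecidableEq ι] (z : ι → ℂ) (i : ι) (w : ℂ) :
    pairProd (Function.update z i w) = (∏ j ∈ Finset.univ.erase i, ‖w - z j‖) ^ 2 *
      ∏ a ∈ Finset.univ.erase i, ∏ b ∈ (Finset.univ.erase a).erase i, ‖z a - z b‖ := by
  rw [pairProd_eq_sq_mul _ i]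
  congr 1
  · congr 1
    refine Finset.prod_congr rfl fun j hj => ?_
    rw [Function.update_self, Function.update_of_ne (Finset.ne_of_mem_erase hj)]
  · refine Finset.prod_congr rfl fun a ha => Finset.prod_congr rfl fun b hb => ?_
    rw [Function.update_of_ne (Finset.ne_of_mem_erase ha),
      Function.update_of_ne (Finset.ne_of_mem_erase hb)]

/-- If no monic polynomial of degree `m` vanishes on `X`, then `X` has more than `m` points:
otherwise their monic polynomial times a power of the variable would vanish on `X`. -/
theorem exists_injective_of_forall_monic {X : Set ℂ} {m : ℕ}
    (h : ∀ p : Polynomial ℂ, p.Monic → p.natDegree = m → ∃ w ∈ X, p.eval w ≠ 0) :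
    ∃ z : Fin (m + 1) → X, Function.Injective z := by
  have hcard : ((m + 1 : ℕ) : ℕ∞) ≤ X.encard := by
    by_contra hlt
    rw [not_le] at hlt
    have hfin : X.Finite := Set.finite_of_encard_le_coe hlt.le
    have hle : hfin.toFinset.card ≤ m := by
      rw [hfin.encard_eq_coe_toFinset_card] at hlt
      exact Nat.lt_succ_iff.1 (by exact_mod_cast hlt)
    obtain ⟨w, hw, hne⟩ := h
      ((∏ a ∈ hfin.toFinset, (Polynomial.X - Polynomial.C a)) *
        Polynomial.X ^ (m - hfin.toFinset.card))
      ((Polynomial.monic_prod_of_monic _ _ fun a _ => Polynomial.monic_X_sub_C a).mul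
        (Polynomial.monic_X_pow _))
      (by
        rw [(Polynomial.monic_prod_of_monic _ _ fun a _ => Polynomial.monic_X_sub_C a).natDegree_mul
          (Polynomial.monic_X_pow _), Polynomial.natDegree_X_pow,
          Polynomial.natDegree_prod_of_monic _ _ fun a _ => Polynomial.monic_X_sub_C a]
        simp
        omega)
    apply hne
    rw [Polynomial.eval_mul, Polynomial.eval_prod,
      Finset.prod_eq_zero (hfin.mem_toFinset.2 hw) (by simp), zero_mul]
  obtain ⟨s, hsX, hs⟩ := Set.exists_subset_encard_eq hcard
  have hsfin : s.Finite := Set.finite_of_encard_eq_coe hs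
  have hsc : hsfin.toFinset.card = m + 1 := by
    rw [hsfin.encard_eq_coe_toFinset_card] at hs
    exact_mod_cast hs
  let e := (hsfin.toFinset.equivFinOfCardEq hsc).symm
  refine ⟨fun i => ⟨e i, hsX (hsfin.mem_toFinset.1 (e i).2)⟩, fun i j hij => e.injective ?_⟩
  exact Subtype.ext (congrArg (fun x : X => (x : ℂ)) hij)

/-- Fekete's inequality: if every monic polynomial of degree `m` exceeds `η ^ m` somewhere on `X`,
then `m + 1` points of `X` that maximize `pairProd` satisfy `pairProd z ≥ η ^ (m (m + 1))`. -/
theorem exists_pow_le_pairProd {X : Set ℂ} (hX : IsCompact X) {m : ℕ} {η : ℝ} (hη : 0 ≤ η)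
    (h : ∀ p : Polynomial ℂ, p.Monic → p.natDegree = m → ∃ w ∈ X, η ^ m < ‖p.eval w‖) :
    ∃ z : Fin (m + 1) → X, 0 < pairProd (fun i => (z i : ℂ)) ∧
      (η ^ m) ^ (m + 1) ≤ pairProd (fun i => (z i : ℂ)) := by
  have : CompactSpace X := isCompact_iff_compactSpace.1 hX
  obtain ⟨z₀, hz₀⟩ := exists_injective_of_forall_monic (X := X) (m := m) fun p hp hd => by
    obtain ⟨w, hw, hlt⟩ := h p hp hd
    exact ⟨w, hw, norm_pos_iff.1 ((pow_nonneg hη m).trans_lt hlt)⟩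
  obtain ⟨z, -, hz⟩ := (isCompact_univ (X := Fin (m + 1) → X)).exists_isMaxOn ⟨z₀, Set.mem_univ _⟩
    (f := fun z => pairProd fun i => (z i : ℂ))
    (continuous_pairProd.comp (by fun_prop)).continuousOn
  have hmax (y : Fin (m + 1) → X) :
      pairProd (fun i => (y i : ℂ)) ≤ pairProd (fun i => (z i : ℂ)) := hz (Set.mem_univ y)
  have hpos : 0 < pairProd (fun i => (z i : ℂ)) :=
    (pairProd_pos (Subtype.val_injective.comp hz₀)).trans_le (hmax z₀)
  refine ⟨z, hpos, ?_⟩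
  calc (η ^ m) ^ (m + 1) = ∏ _i : Fin (m + 1), η ^ m := by simp
    _ ≤ pairProd (fun i => (z i : ℂ)) :=
      Finset.prod_le_prod (fun _ _ => pow_nonneg hη m) fun i _ => ?_
  -- Moving `z i` to `w` cannot increase `pairProd`, so the factor of `z i` is at least that of `w`.
  obtain ⟨w, hw, hlt⟩ := h (∏ j ∈ Finset.univ.erase i, (Polynomial.X - Polynomial.C (z j : ℂ)))
    (Polynomial.monic_prod_of_monic _ _ fun a _ => Polynomial.monic_X_sub_C _)
    (by
      rw [Polynomial.natDegree_prod_of_monic _ _ fun a _ => Polynomial.monic_X_sub_C _]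
      simp)
  rw [Polynomial.eval_prod, norm_prod] at hlt
  simp only [Polynomial.eval_sub, Polynomial.eval_X, Polynomial.eval_C] at hlt
  refine hlt.le.trans ?_
  have hupd := hmax (Function.update z i ⟨w, hw⟩)
  have heq : (fun j => ((Function.update z i ⟨w, hw⟩ : Fin (m + 1) → X) j : ℂ)) =
      Function.update (fun j => (z j : ℂ)) i w := by
    ext j
    by_cases hj : j = i
    · subst hj; simp
    · simp [Function.update_of_ne hj]
  rw [heq, pairProd_update_eq, pairProd_eq_sq_mul _ i] at hupd
  rw [pairProd_eq_sq_mul _ i] at hpos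
  have hR := pos_of_mul_pos_right hpos (sq_nonneg _)
  exact le_of_sq_le_sq (le_of_mul_le_mul_right hupd hR)
    (Finset.prod_nonneg fun _ _ => norm_nonneg _)

/-- The logarithmic kernel `log |z - w|`, truncated below at `log δ`. -/
noncomputable def truncLog {E : Type*} [PseudoMetricSpace E] (δ : ℝ) (p : E × E) : ℝ :=
  Real.log (max (dist p.1 p.2) δ)

theorem continuous_truncLog {E : Type*} [PseudoMetricSpace E] {δ : ℝ} (hδ : 0 < δ) :
    Continuous (truncLog δ : E × E → ℝ) := by
  unfold truncLog
  exact (by fun_prop : Continuous fun p : E × E => max (dist p.1 p.2) δ).log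
    fun p => (hδ.trans_le (le_max_right _ _)).ne'

/-- The uniform probability measure on a finite family of points. -/
noncomputable def uniformMeasure {E : Type*} [MeasurableSpace E] {m : ℕ} (z : Fin (m + 1) → E) :
    ProbabilityMeasure E :=
  ⟨((m + 1 : ℕ) : ℝ≥0∞)⁻¹ • ∑ i, Measure.dirac (z i), ⟨by
    simp [ENNReal.inv_mul_cancel]⟩⟩

theorem integral_uniformMeasure {E : Type*} [MeasurableSpace E] {m : ℕ} (z : Fin (m + 1) → E)
    {f : E → ℝ} (hf : StronglyMeasurable f) :
    ∫ x, f x ∂(uniformMeasure z : Measure E) = ((m : ℝ) + 1)⁻¹ * ∑ i, f (z i) := by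
  rw [uniformMeasure, ProbabilityMeasure.coe_mk, integral_smul_measure,
    integral_finsetSum_measure fun i _ => integrable_dirac' hf (by simp)]
  have hm : (((m + 1 : ℕ) : ℝ≥0∞)⁻¹).toReal = ((m : ℝ) + 1)⁻¹ := by
    rw [ENNReal.toReal_inv, ENNReal.toReal_natCast]
    push_cast
    rfl
  simp only [integral_dirac' _ _ hf, hm, smul_eq_mul]

theorem integral_prod_uniformMeasure {E : Type*} [MetricSpace E] [CompactSpace E]
    [MeasurableSpace E] [BorelSpace E] {m : ℕ} (z : Fin (m + 1) → E) {f : E × E → ℝ}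
    (hf : Continuous f) :
    ∫ p, f p ∂((uniformMeasure z).prod (uniformMeasure z) : Measure (E × E)) =
      ((m : ℝ) + 1)⁻¹ * ((m : ℝ) + 1)⁻¹ * ∑ i, ∑ j, f (z i, z j) := by
  have hint : Integrable f ((uniformMeasure z : Measure E).prod (uniformMeasure z : Measure E)) :=
    hf.integrable_of_hasCompactSupport (HasCompactSupport.of_compactSpace f)
  rw [ProbabilityMeasure.toMeasure_prod, integral_prod _ hint, integral_uniformMeasure z
    (f := fun x => ∫ y, f (x, y) ∂(uniformMeasure z : Measure E))]
  · simp_rw [fun x => integral_uniformMeasure z (f := fun y => f (x, y))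
      (by fun_prop : Continuous fun y => f (x, y)).stronglyMeasurable]
    rw [← Finset.mul_sum, mul_assoc]
  · exact StronglyMeasurable.integral_prod_right (f := fun x y => f (x, y)) hf.stronglyMeasurable

/-- In the double sum of `truncLog δ` over `m + 1` points the off-diagonal part is at least
`log (pairProd z)`, and the diagonal, which the truncation makes finite, contributes `log δ` per
point; its share vanishes as `m → ∞`. -/
theorem le_integral_truncLog_uniformMeasure {X : Set ℂ} [CompactSpace X] {m : ℕ} {η δ : ℝ}
    (hη : 0 < η) (hδ : 0 < δ) (z : Fin (m + 1) → X)
    (hz : 0 < pairProd (fun i => (z i : ℂ)))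
    (hle : (η ^ m) ^ (m + 1) ≤ pairProd (fun i => (z i : ℂ))) :
    Real.log η + ((m : ℝ) + 1)⁻¹ * (Real.log δ - Real.log η) ≤
      ∫ p, truncLog δ p ∂((uniformMeasure z).prod (uniformMeasure z) : Measure (X × X)) := by
  rw [integral_prod_uniformMeasure z (continuous_truncLog hδ)]
  have hne (i) : ∏ j ∈ Finset.univ.erase i, ‖(z i : ℂ) - z j‖ ≠ 0 :=
    Finset.prod_ne_zero_iff.1 hz.ne' i (Finset.mem_univ i)
  have hsum : ((m : ℝ) + 1) * m * Real.log η + ((m : ℝ) + 1) * Real.log δ ≤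
      ∑ i, ∑ j, truncLog δ (z i, z j) := by
    have hlog := Real.log_le_log (by positivity) hle
    rw [Real.log_pow, Real.log_pow, pairProd, Real.log_prod fun i _ => hne i] at hlog
    calc _ ≤ ∑ i : Fin (m + 1), (Real.log (∏ j ∈ Finset.univ.erase i, ‖(z i : ℂ) - z j‖)
          + Real.log δ) := by
          rw [Finset.sum_add_distrib]
          push_cast at hlog
          simp only [Finset.sum_const, Finset.card_univ, Fintype.card_fin, nsmul_eq_mul]
          push_cast
          linarith
      _ ≤ _ := by
          refine Finset.sum_le_sum fun i _ => ?_
          rw [← Finset.add_sum_erase _ _ (Finset.mem_univ i), add_comm,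
            Real.log_prod (Finset.prod_ne_zero_iff.1 (hne i))]
          refine add_le_add ?_ (Finset.sum_le_sum fun j hj => ?_)
          · simp [truncLog, hδ.le]
          · have : 0 < ‖(z i : ℂ) - z j‖ :=
              (norm_nonneg _).lt_of_ne' (Finset.prod_ne_zero_iff.1 (hne i) j hj)
            refine Real.log_le_log this ?_
            simp [Subtype.dist_eq, dist_eq_norm]
  have hm : (0 : ℝ) < (m : ℝ) + 1 := by positivity
  calc _ = ((m : ℝ) + 1)⁻¹ * ((m : ℝ) + 1)⁻¹ *
        (((m : ℝ) + 1) * m * Real.log η + ((m : ℝ) + 1) * Real.log δ) := by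
        field_simp
        ring
    _ ≤ _ := by gcongr

/-- The positive part of `log` in real terms; at `dist x y = 0` the junk value `Real.log 0 = 0`
agrees with the positive part of `-∞`. -/
theorem toENNReal_log_edist {E : Type*} [PseudoMetricSpace E] (x y : E) :
    (ENNReal.log (edist x y)).toENNReal = ENNReal.ofReal (Real.log (dist x y)) := by
  rw [edist_dist, ENNReal.log_ofReal]
  split_ifs with h
  · simp [le_antisymm h dist_nonneg]
  · simp

/-- The negative part of `log` is the increasing limit of its truncations, also where
`dist x y = 0`: there both sides are `∞`. -/
theorem toENNReal_neg_log_edist {E : Type*} [PseudoMetricSpace E] (x y : E) :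
    (-ENNReal.log (edist x y)).toENNReal =
      ⨆ M : ℕ, ENNReal.ofReal (-truncLog (Real.exp (-(M : ℝ))) (x, y)) := by
  rw [edist_dist, ENNReal.log_ofReal]
  split_ifs with h
  · simp [truncLog, le_antisymm h dist_nonneg, (Real.exp_pos _).le, ENNReal.iSup_natCast]
  · rw [not_le] at h
    rw [← EReal.coe_neg, EReal.toENNReal_of_ne_top (by simp), EReal.toReal_coe]
    apply le_antisymm
    · obtain ⟨M, hM⟩ := exists_nat_ge (-Real.log (dist x y))
      refine le_iSup_of_le M (ENNReal.ofReal_le_ofReal ?_)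
      have : Real.exp (-(M : ℝ)) ≤ dist x y := by
        rw [← Real.le_log_iff_exp_le h]
        linarith
      simp [truncLog, max_eq_left this]
    · refine iSup_le fun M => ENNReal.ofReal_le_ofReal (neg_le_neg ?_)
      exact Real.log_le_log h (le_max_left _ _)

theorem truncLog_antitone {E : Type*} [PseudoMetricSpace E] {δ₁ δ₂ : ℝ} (h₁ : 0 < δ₁)
    (h : δ₁ ≤ δ₂) (p : E × E) : truncLog δ₁ p ≤ truncLog δ₂ p :=
  Real.log_le_log (h₁.trans_le (le_max_right _ _)) (max_le_max le_rfl h)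

theorem ofReal_truncLog {E : Type*} [PseudoMetricSpace E] {δ : ℝ} (hδ : 0 < δ) (h1 : δ ≤ 1)
    (p : E × E) :
    ENNReal.ofReal (truncLog δ p) = ENNReal.ofReal (Real.log (dist p.1 p.2)) := by
  rcases le_total δ (dist p.1 p.2) with h | h
  · rw [truncLog, max_eq_left h]
  · rw [truncLog, max_eq_right h, ENNReal.ofReal_of_nonpos (Real.log_nonpos hδ.le h1),
      ENNReal.ofReal_of_nonpos (Real.log_nonpos dist_nonneg (h.trans h1))]

/-- A lower bound for all truncated energies is one for the energy, by monotone
convergence of the negative parts; the positive parts do not depend on the truncation level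
`exp (-M) ≤ 1`. -/
theorem le_logEnergy_of_forall_truncLog {X : Set ℂ} [CompactSpace X] (μ : ProbabilityMeasure X)
    {L : ℝ} (h : ∀ M : ℕ, L ≤ ∫ p, truncLog (Real.exp (-(M : ℝ))) p ∂(μ.prod μ : Measure (X × X))) :
    (L : EReal) ≤ logEnergy ((μ : Measure X).map Subtype.val) := by
  have hval : Measurable (Subtype.val : X → ℂ) := measurable_subtype_coe
  rw [logEnergy, Measure.map_prod_map _ _ hval hval,
    lintegral_map (by fun_prop) (by fun_prop), lintegral_map (by fun_prop) (by fun_prop)]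
  simp only [Prod.map_fst, Prod.map_snd, ← Subtype.edist_eq]
  simp only [toENNReal_log_edist, toENNReal_neg_log_edist, Prod.mk.eta]
  have hexp (M : ℕ) : Real.exp (-(M : ℝ)) ≤ 1 := Real.exp_le_one_iff.2 (by simp)
  have hcont (M : ℕ) : Continuous (truncLog (Real.exp (-(M : ℝ))) : X × X → ℝ) :=
    continuous_truncLog (Real.exp_pos _)
  have hint (M : ℕ) : Integrable (truncLog (Real.exp (-(M : ℝ))) : X × X → ℝ)
      ((μ : Measure X).prod (μ : Measure X)) :=
    (hcont M).integrable_of_hasCompactSupport (HasCompactSupport.of_compactSpace _)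
  rw [lintegral_iSup (fun M => by have := (hcont M).measurable; fun_prop)
    (fun M N hMN p => ENNReal.ofReal_le_ofReal (neg_le_neg
      (truncLog_antitone (Real.exp_pos _) (Real.exp_le_exp.2 (by simpa using hMN)) p)))]
  set P := ∫⁻ p : X × X, ENNReal.ofReal (Real.log (dist p.1 p.2))
    ∂((μ : Measure X).prod (μ : Measure X)) with hP
  have hPfin : P ≠ ⊤ := by
    have := (hint 0).lintegral_lt_top
    simp only [ofReal_truncLog (Real.exp_pos _) (hexp 0)] at this
    exact this.ne
  have hle (M : ℕ) : ∫⁻ p : X × X, ENNReal.ofReal (-truncLog (Real.exp (-(M : ℝ))) p)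
      ∂((μ : Measure X).prod (μ : Measure X)) ≤ ENNReal.ofReal (P.toReal - L) := by
    have hM := h M
    rw [ProbabilityMeasure.toMeasure_prod,
      integral_eq_lintegral_pos_part_sub_lintegral_neg_part (hint M)] at hM
    simp only [ofReal_truncLog (Real.exp_pos _) (hexp M), ← hP] at hM
    have hfin : ∫⁻ p : X × X, ENNReal.ofReal (-truncLog (Real.exp (-(M : ℝ))) p)
      ∂((μ : Measure X).prod (μ : Measure X)) ≠ ⊤ := (hint M).neg.lintegral_lt_top.ne
    rw [← ENNReal.ofReal_toReal hfin]
    exact ENNReal.ofReal_le_ofReal (by linarith)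
  have hL : 0 ≤ P.toReal - L := by
    have hM := h 0
    rw [ProbabilityMeasure.toMeasure_prod,
      integral_eq_lintegral_pos_part_sub_lintegral_neg_part (hint 0)] at hM
    simp only [ofReal_truncLog (Real.exp_pos _) (hexp 0), ← hP] at hM
    linarith [ENNReal.toReal_nonneg (a := ∫⁻ p : X × X, ENNReal.ofReal
      (-truncLog (Real.exp (-((0 : ℕ) : ℝ))) p) ∂((μ : Measure X).prod (μ : Measure X)))]
  calc (L : EReal) = ((P.toReal : ℝ) : EReal) - ((P.toReal - L : ℝ) : EReal) := by
        rw [← EReal.coe_sub]; simp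
    _ = (P : EReal) - (ENNReal.ofReal (P.toReal - L) : EReal) := by
        rw [EReal.coe_ennreal_ofReal, max_eq_left hL, EReal.coe_ennreal_toReal hPfin]
    _ ≤ _ := EReal.sub_le_sub le_rfl (EReal.coe_ennreal_le_coe_ennreal_iff.2 (iSup_le hle))

theorem logCapacity_lt_top {X : Set ℂ} (hX : IsCompact X) : logCapacity X < ⊤ := by
  rw [logCapacity, EReal.exp_lt_top_iff]
  refine lt_of_le_of_lt (b := ((Real.log (Metric.diam X + 1) : ℝ) : EReal)) ?_ (EReal.coe_lt_top _)
  refine iSup₂_le fun μ hμ => ?_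
  have := hμ.1
  have hae : ∀ᵐ x ∂μ, x ∈ X := hμ.2
  have hlog : 0 ≤ Real.log (Metric.diam X + 1) :=
    Real.log_nonneg (by linarith [Metric.diam_nonneg (s := X)])
  have hpos : ∫⁻ p : ℂ × ℂ, (ENNReal.log (edist p.1 p.2)).toENNReal ∂(μ.prod μ) ≤
      ENNReal.ofReal (Real.log (Metric.diam X + 1)) := by
    calc _ ≤ ∫⁻ _p : ℂ × ℂ, ENNReal.ofReal (Real.log (Metric.diam X + 1)) ∂(μ.prod μ) := by
          refine lintegral_mono_ae ?_
          filter_upwards [Measure.quasiMeasurePreserving_fst.ae hae,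
            Measure.quasiMeasurePreserving_snd.ae hae] with p h1 h2
          rw [toENNReal_log_edist]
          refine ENNReal.ofReal_le_ofReal ?_
          rcases (dist_nonneg (x := p.1) (y := p.2)).eq_or_lt with h0 | h0
          · rw [← h0, Real.log_zero]
            exact hlog
          · refine Real.log_le_log h0 ?_
            linarith [Metric.dist_le_diam_of_mem hX.isBounded h1 h2]
      _ = _ := by simp
  calc logEnergy μ ≤ ((ENNReal.ofReal (Real.log (Metric.diam X + 1)) : ℝ≥0∞) : EReal) - 0 :=
        EReal.sub_le_sub (EReal.coe_ennreal_le_coe_ennreal_iff.2 hpos) (EReal.coe_ennreal_nonneg _)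
    _ = _ := by rw [sub_zero, EReal.coe_ennreal_ofReal, max_eq_left hlog]

/-- The half of the Fekete–Szegő theorem which bounds the Chebyshev constants
`(min_p ‖p‖_X) ^ (1 / m)`, for `p` monic of degree `m`, asymptotically by the capacity. -/
theorem eventually_exists_monic_norm_eval_le {X : Set ℂ} (hX : IsCompact X) {η : ℝ}
    (hη : (logCapacity X).toReal < η) :
    ∀ᶠ m : ℕ in atTop, ∃ p : Polynomial ℂ, p.Monic ∧ p.natDegree = m ∧
      ∀ w ∈ X, ‖p.eval w‖ ≤ η ^ m := by
  have hη0 : 0 < η := ENNReal.toReal_nonneg.trans_lt hη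
  have : CompactSpace X := isCompact_iff_compactSpace.1 hX
  -- Otherwise Fekete's inequality applies for infinitely many degrees, and a weak limit of uniform
  -- measures on the resulting points has energy at least `log η`.
  by_contra hnot
  rw [not_eventually] at hnot
  push Not at hnot
  obtain ⟨φ, hφ, hbad⟩ := extraction_of_frequently_atTop hnot
  choose z hz hle using fun n => exists_pow_le_pairProd hX hη0.le (hbad n)
  obtain ⟨μ, hμ⟩ : ∃ μ, Tendsto (fun n => uniformMeasure (z n)) (hyperfilter ℕ) (𝓝 μ) :=
    ⟨_, ((hyperfilter ℕ).map fun n => uniformMeasure (z n)).le_nhds_lim⟩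
  have hprod := (ProbabilityMeasure.continuous_prod.tendsto (μ, μ)).comp (hμ.prodMk_nhds hμ)
  have henergy : ((Real.log η : ℝ) : EReal) ≤ logEnergy ((μ : Measure X).map Subtype.val) := by
    refine le_logEnergy_of_forall_truncLog μ fun M => ?_
    have hδ := Real.exp_pos (-(M : ℝ))
    have hlim := ((ProbabilityMeasure.continuous_integral_continuousMap
      (⟨_, continuous_truncLog hδ⟩ : C(X × X, ℝ))).tendsto _).comp hprod
    have hinv : Tendsto (fun n => ((φ n : ℝ) + 1)⁻¹) (hyperfilter ℕ) (𝓝 0) :=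
      ((tendsto_inv_atTop_zero.comp (tendsto_atTop_add_const_right _ _
        (tendsto_natCast_atTop_atTop.comp hφ.tendsto_atTop))).mono_left Nat.hyperfilter_le_atTop)
    have hlow := (hinv.mul_const (Real.log (Real.exp (-(M : ℝ))) - Real.log η)).const_add
      (Real.log η)
    rw [zero_mul, add_zero] at hlow
    exact le_of_tendsto_of_tendsto' hlow hlim fun n =>
      le_integral_truncLog_uniformMeasure hη0 hδ (z n) (hz n) (hle n)
  have hcap : ENNReal.ofReal η ≤ logCapacity X := by
    rw [← Real.exp_log hη0, ← EReal.exp_coe, logCapacity, EReal.exp_le_exp_iff]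
    refine henergy.trans (le_iSup₂_of_le ((μ : Measure X).map Subtype.val) ⟨?_, ?_⟩ le_rfl)
    · exact Measure.isProbabilityMeasure_map measurable_subtype_coe.aemeasurable
    · rw [Measure.map_apply measurable_subtype_coe hX.measurableSet.compl]
      simp
  rw [ENNReal.ofReal_le_iff_le_toReal (logCapacity_lt_top hX).ne] at hcap
  exact hcap.not_gt hη

/-! ### The bound in terms of capacity -/

/-- Monic polynomials `p` of every degree `m` with `‖p‖_X ≤ r m ^ m`, where `r m` tends to `cap X`. -/
theorem exists_tendsto_logCapacity {X : Set ℂ} (hX : IsCompact X) :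
    ∃ r : ℕ → ℝ, Tendsto r atTop (𝓝 (logCapacity X).toReal) ∧
      ∀ m, 0 ≤ r m ∧ ∃ p : Polynomial ℂ, p.Monic ∧ p.natDegree = m ∧
        ∀ w ∈ X, ‖p.eval w‖ ≤ r m ^ m := by
  set c := (logCapacity X).toReal with hc
  let S (m : ℕ) : Set ℝ := {η | c ≤ η ∧ ∃ p : Polynomial ℂ, p.Monic ∧ p.natDegree = m ∧
    ∀ w ∈ X, ‖p.eval w‖ ≤ η ^ m}
  have hbdd (m : ℕ) : BddBelow (S m) := ⟨c, fun η h => h.1⟩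
  have hne (m : ℕ) : (S m).Nonempty := by
    obtain ⟨R, hR⟩ := hX.isBounded.exists_norm_le
    refine ⟨max c R, le_max_left _ _, Polynomial.X ^ m, Polynomial.monic_X_pow m,
      Polynomial.natDegree_X_pow m, fun w hw => ?_⟩
    rw [Polynomial.eval_pow, Polynomial.eval_X, norm_pow]
    exact pow_le_pow_left₀ (norm_nonneg w) ((hR w hw).trans (le_max_right _ _)) m
  -- The slack `1 / (m + 1)` makes it unnecessary that `sInf (S m)` be attained.
  choose r hrS hr using fun m => exists_lt_of_csInf_lt (hne m)
    (lt_add_of_pos_right (sInf (S m)) (Nat.one_div_pos_of_nat (α := ℝ) (n := m)))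
  refine ⟨r, ?_, fun m => ⟨ENNReal.toReal_nonneg.trans (hrS m).1, (hrS m).2⟩⟩
  rw [tendsto_order]
  refine ⟨fun a ha => Eventually.of_forall fun m => ha.trans_le (hrS m).1, fun a ha => ?_⟩
  obtain ⟨b, hcb, hba⟩ := exists_between ha
  filter_upwards [eventually_exists_monic_norm_eval_le hX hcb,
    (tendsto_one_div_add_atTop_nhds_zero_nat (𝕜 := ℝ)).eventually_lt_const (sub_pos.2 hba)]
    with m hm hsmall
  linarith [hr m, csInf_le (hbdd m) (show b ∈ S m from ⟨hcb.le, hm⟩)]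

theorem theorem1 (X : Set ℂ) (hX : IsCompact X) (hcap : 0 < logCapacity X) :
    ∃ ε : ℕ → ℝ, Tendsto ε atTop (𝓝 0) ∧
      ∀ (n k : ℕ), 0 < n → 0 < k →
      ∀ (A : Matrix (Fin n) (Fin n) ℂ) (B : Matrix (Fin n) (Fin k) ℂ)
        (V : Matrix (Fin n) (Fin n) ℂ) (d : Fin n → ℂ),
        IsUnit V → V * A * V⁻¹ = Matrix.diagonal d → spectrum ℂ A ⊆ X →
        lambdaMin (gramian_isHermitian A B (tMin n k)) ≤
          condNumber V ^ 2 * frobeniusNorm B ^ 2 *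
            ((1 + ε (tMin n k)) * (logCapacity X).toReal ^ 2) ^ tMin n k := by
  have hc : 0 < (logCapacity X).toReal := ENNReal.toReal_pos hcap.ne' (logCapacity_lt_top hX).ne
  obtain ⟨r, hr, hpoly⟩ := exists_tendsto_logCapacity hX
  -- `ε` is chosen so that `(1 + ε m) cap² = (r m)²`.
  refine ⟨fun m => (r m / (logCapacity X).toReal) ^ 2 - 1, ?_, ?_⟩
  · simpa [div_self hc.ne'] using ((hr.div_const (logCapacity X).toReal).pow 2).sub_const 1
  · intro n k hn hk A B V d hV hd hspec
    obtain ⟨h0, p, hp, hdeg, hpX⟩ := hpoly (tMin n k)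
    refine (lambdaMin_gramian_le (tMin_mul_lt hn hk) A B hV hd hp hdeg (pow_nonneg h0 _)
      fun i => hpX _ (hspec (diagonal_mem_spectrum hV hd i))).trans_eq ?_
    rw [add_sub_cancel, div_pow, div_mul_cancel₀ _ (pow_ne_zero 2 hc.ne'), pow_right_comm]
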